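/- Let $\lambda\in\mathbb{R}$, $L>0$, and let $\gamma:[0,L]\to\mathbb{R}^3$ be a $C^\infty$ curve parametrized by arclength (i.e. $|\gamma'|\equiv 1$; so $\partial_s$ is the ordinary derivative) that is a $\lambda$-elastica, i.e. on $[0,L]$ $$2\gamma_{ssss}+6\langle\gamma_{ss},\gamma_{sss}\rangle\gamma_s+3|\gamma_{ss}|^2\gamma_{ss}-\lambda\gamma_{ss}=0 .$$ Suppose that $\gamma$ is not a straight segment, and let $\kappa:=\gamma_{ss}$. For $m\in[0,1)$ let $\operatorname{sn}(x,m):=\sin(\operatorname{am}(x,m))$, where $\operatorname{am}(\cdot,m):\mathbb{R}\to\mathbb{R}$ is the inverse function of $x\mapsto\int_0^x(1-m\sin^2\theta)^{-1/2}\,d\theta$, and let $\operatorname{sn}(x,1):=\tanh x$. Then there is exactly one quadruple $(m,w,A,c)\in\mathbb{R}^4$ that satisfies $$0\le m\le w\le 1,\qquad w>0,\qquad A>0$$ together with the following four conditions: 1. for some $s_0\in\mathbb{R}$ and all $s\in[0,L]$, $$|\kappa(s)|^2=A^2\left(1-\frac{m}{w}\operatorname{sn}^2\Big(\frac{A}{2\sqrt{w}}\,s+s_0,\;m\Big)\right);$$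 2. for all $s\in[0,L]$, $\det\big(\gamma_s(s)\ \gamma_{ss}(s)\ \gamma_{sss}(s)\big)=c$; 3. $\displaystyle\lambda=\frac{A^2}{2w}(3w-m-1)$; 4. $\displaystyle 4c^2=\frac{A^6}{w^2}(1-w)(w-m)$. -/

import Mathlib

open scoped ContDiff

noncomputable section

namespace Elastica

/-- A smooth curve `γ : [a, b] → ℝⁿ`: a map that is `C^∞` up to the boundary of `[a, b]`, `a < b`,
with nowhere vanishing derivative (one-sided at the end points). Only the values of `γ` on `[a, b]`
matter. -/
structure IsSmoothCurve {n : ℕ} (a b : ℝ) (γ : ℝ → EuclideanSpace ℝ (Fin n)) : Prop where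
  lt : a < b
  contDiffOn : ContDiffOn ℝ ∞ γ (Set.Icc a b)
  deriv_ne_zero : ∀ x ∈ Set.Icc a b, derivWithin γ (Set.Icc a b) x ≠ 0

/-- The arclength derivative `∂ₛψ = ψ' / |γ'|` along the curve `γ : [a, b] → ℝⁿ`. -/
def arcDeriv {n d : ℕ} (a b : ℝ) (γ : ℝ → EuclideanSpace ℝ (Fin n))
    (ψ : ℝ → EuclideanSpace ℝ (Fin d)) : ℝ → EuclideanSpace ℝ (Fin d) :=
  fun x => ‖derivWithin γ (Set.Icc a b) x‖⁻¹ • derivWithin ψ (Set.Icc a b) x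

/-- The `k`-th iterated arclength derivative `∂ₛᵏγ` of the curve `γ` itself. -/
def arcIter {n : ℕ} (a b : ℝ) (γ : ℝ → EuclideanSpace ℝ (Fin n)) (k : ℕ) :
    ℝ → EuclideanSpace ℝ (Fin n) :=
  (arcDeriv a b γ)^[k] γ

/-- The curvature vector `κ = ∂ₛ²γ`. -/
def curvature {n : ℕ} (a b : ℝ) (γ : ℝ → EuclideanSpace ℝ (Fin n)) :
    ℝ → EuclideanSpace ℝ (Fin n) :=
  arcIter a b γ 2

/-- A smooth curve `γ : [a, b] → ℝⁿ` is a `lam`-elastica if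
`2 γ_ssss + 6 ⟨γ_ss, γ_sss⟩ γ_s + 3 |γ_ss|² γ_ss - lam γ_ss = 0` on `[a, b]`. -/
structure IsElastica {n : ℕ} (lam a b : ℝ) (γ : ℝ → EuclideanSpace ℝ (Fin n)) : Prop where
  smooth : IsSmoothCurve a b γ
  equation : ∀ x ∈ Set.Icc a b,
    (2 : ℝ) • arcIter a b γ 4 x
      + (6 * inner ℝ (arcIter a b γ 2 x) (arcIter a b γ 3 x)) • arcIter a b γ 1 x
      + (3 * ‖arcIter a b γ 2 x‖ ^ 2) • arcIter a b γ 2 x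
      - lam • arcIter a b γ 2 x = 0

/-- `γ : [a, b] → ℝⁿ` is parametrized by arclength. -/
def IsArclength {n : ℕ} (a b : ℝ) (γ : ℝ → EuclideanSpace ℝ (Fin n)) : Prop :=
  ∀ x ∈ Set.Icc a b, ‖derivWithin γ (Set.Icc a b) x‖ = 1

/-- The curve `γ : [a, b] → ℝⁿ` is a straight segment: its image is a line segment. -/
def IsStraightSegment {n : ℕ} (a b : ℝ) (γ : ℝ → EuclideanSpace ℝ (Fin n)) : Prop :=
  ∃ p q : EuclideanSpace ℝ (Fin n), γ '' Set.Icc a b = segment ℝ p q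

/-- `det (γ_s γ_ss γ_sss)` at `x` for a curve in `ℝ³`; the three vectors are the columns. -/
def detFrame (a b : ℝ) (γ : ℝ → EuclideanSpace ℝ (Fin 3)) (x : ℝ) : ℝ :=
  (Matrix.of fun i j : Fin 3 => arcIter a b γ ((j : ℕ) + 1) x i).det

/-- The incomplete elliptic integral of the first kind with parameter `m` (the square of the
modulus), used for `0 ≤ m < 1`. -/
def ellipticF (x m : ℝ) : ℝ :=
  ∫ θ in (0 : ℝ)..x, 1 / Real.sqrt (1 - m * Real.sin θ ^ 2)

/-- The Jacobi amplitude: the inverse function of the bijection `ellipticF · m` of `ℝ`,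
used for `0 ≤ m < 1`. -/
def jacobiAm (x m : ℝ) : ℝ :=
  Function.invFun (fun φ => ellipticF φ m) x

/-- The Jacobi elliptic sine with parameter `m ∈ [0, 1]`. -/
def jacobiSn (x m : ℝ) : ℝ :=
  if m = 1 then Real.tanh x else Real.sin (jacobiAm x m)

end Elastica

end

/-! Let T, K, J be the first three arclength derivatives of γ and u = |K|². Differentiating |T|² = 1
gives ⟨T,K⟩ = 0 and ⟨T,J⟩ = -u. The elastica equation yields two first integrals: c = det(T K J) and
e = |J|² - (3/4)u² - (lam/2)u. Expanding c² as a Gram determinant then gives u'² = P(u) with P(t) =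
-t³ + 2 lam t² + 4et - 4c² (`exists_curvature_equation`).

Since γ is not straight, u > 0 somewhere, and there P ≥ 0. This forces real roots x ≤ 0 ≤ y ≤ u ≤ z
(`exists_ordered_roots`). The parameters are coordinates for these roots: z = A², y = A²(w - m)/w, x
= A²(w - 1)/w. Conditions 3 and 4 are Vieta's formulas for their sum and product.

Existence: the sn profile solves the same equation (`curvatureProfile_equation`), so it suffices to
match value and derivative at one point. The differentiated, second-order equation is used for this
because u'² = P(u) loses uniqueness at roots of P.

Uniqueness: condition 1 forces the remaining symmetric function of the roots to be -4e. The ordered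
roots, hence m, w, A, are then determined, and c is the determinant. -/

namespace Elastica

/-! ### Jacobi amplitude and elliptic sine. -/

section JacobiFunctions

variable {m : ℝ}

lemma one_sub_mul_sin_sq_pos (h1 : m < 1) (x : ℝ) : 0 < 1 - m * Real.sin x ^ 2 := by
  rcases (sq_nonneg (Real.sin x)).eq_or_lt with h | h
  · simp [← h]
  · nlinarith [Real.sin_sq_le_one x]

lemma hasDerivAt_ellipticF (h1 : m < 1) (x : ℝ) :
    HasDerivAt (fun φ => ellipticF φ m) (1 / Real.sqrt (1 - m * Real.sin x ^ 2)) x := by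
  have hc : Continuous fun θ : ℝ => 1 / Real.sqrt (1 - m * Real.sin θ ^ 2) := by
    refine continuous_const.div (by fun_prop) fun θ => ?_
    exact (Real.sqrt_pos.2 (one_sub_mul_sin_sq_pos h1 θ)).ne'
  exact intervalIntegral.integral_hasDerivAt_right (hc.intervalIntegrable _ _)
    (hc.stronglyMeasurableAtFilter _ _) hc.continuousAt

lemma one_le_deriv_ellipticF (h0 : 0 ≤ m) (h1 : m < 1) (x : ℝ) :
    1 ≤ 1 / Real.sqrt (1 - m * Real.sin x ^ 2) := by
  rw [le_div_iff₀ (Real.sqrt_pos.2 (one_sub_mul_sin_sq_pos h1 x)), one_mul]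
  refine Real.sqrt_le_one.2 ?_
  nlinarith [mul_nonneg h0 (sq_nonneg (Real.sin x))]

lemma strictMono_ellipticF (h1 : m < 1) : StrictMono fun φ => ellipticF φ m := by
  refine strictMono_of_hasDerivAt_pos (fun x => hasDerivAt_ellipticF h1 x) fun x => ?_
  have := Real.sqrt_pos.2 (one_sub_mul_sin_sq_pos h1 x)
  positivity

/-- The integrand is at least 1, so F(φ) - φ is monotone and F dominates the identity at both ends.
-/
lemma surjective_ellipticF (h0 : 0 ≤ m) (h1 : m < 1) :
    Function.Surjective fun φ => ellipticF φ m := by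
  have hmono : Monotone fun φ => ellipticF φ m - φ := by
    refine monotone_of_hasDerivAt_nonneg
      (fun x => (hasDerivAt_ellipticF h1 x).sub (hasDerivAt_id x)) fun x => ?_
    simpa using one_le_deriv_ellipticF h0 h1 x
  have hz : ellipticF 0 m = 0 := by simp [ellipticF]
  have hcont : Continuous fun φ => ellipticF φ m :=
    continuous_iff_continuousAt.2 fun x => (hasDerivAt_ellipticF h1 x).continuousAt
  refine hcont.surjective ?_ ?_
  · refine Filter.tendsto_atTop_mono' _ ?_ Filter.tendsto_id
    filter_upwards [Filter.eventually_ge_atTop 0] with x hx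
    have := hmono hx
    simp only [hz] at this
    simp only [id]
    linarith
  · refine Filter.tendsto_atBot_mono' _ ?_ Filter.tendsto_id
    filter_upwards [Filter.eventually_le_atBot 0] with x hx
    have := hmono hx
    simp only [hz] at this
    simp only [id]
    linarith

lemma jacobiAm_ellipticF (h1 : m < 1) (φ : ℝ) : jacobiAm (ellipticF φ m) m = φ :=
  Function.leftInverse_invFun (strictMono_ellipticF h1).injective φ

lemma ellipticF_jacobiAm (h0 : 0 ≤ m) (h1 : m < 1) (x : ℝ) : ellipticF (jacobiAm x m) m = x :=
  Function.rightInverse_invFun (surjective_ellipticF h0 h1) x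

/-- A monotone surjection of ℝ is continuous; this is the input the inverse function rule needs. -/
lemma continuous_jacobiAm (h0 : 0 ≤ m) (h1 : m < 1) : Continuous fun x => jacobiAm x m := by
  have hmono : Monotone fun x => jacobiAm x m := by
    intro x y hxy
    rw [← (strictMono_ellipticF h1).le_iff_le]
    simpa only [ellipticF_jacobiAm h0 h1] using hxy
  exact hmono.continuous_of_surjective fun φ => ⟨_, jacobiAm_ellipticF h1 φ⟩

lemma hasDerivAt_jacobiAm (h0 : 0 ≤ m) (h1 : m < 1) (x : ℝ) :
    HasDerivAt (fun x => jacobiAm x m) (Real.sqrt (1 - m * Real.sin (jacobiAm x m) ^ 2)) x := by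
  have hpos := Real.sqrt_pos.2 (one_sub_mul_sin_sq_pos h1 (jacobiAm x m))
  have h := HasDerivAt.of_local_left_inverse (continuous_jacobiAm h0 h1).continuousAt
    (hasDerivAt_ellipticF h1 (jacobiAm x m)) (by positivity)
    (Filter.Eventually.of_forall fun y => ellipticF_jacobiAm h0 h1 y)
  simpa using h

/-- The Jacobi elliptic sine, its derivative `g`, and the range of its values. -/
lemma exists_deriv_jacobiSn (h0 : 0 ≤ m) (h1 : m ≤ 1) :
    ∃ g : ℝ → ℝ, (∀ x, HasDerivAt (fun x => jacobiSn x m) (g x) x) ∧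
      (∀ x, HasDerivAt g (-(1 + m) * jacobiSn x m + 2 * m * jacobiSn x m ^ 3) x) ∧
      (∀ x, g x ^ 2 = (1 - jacobiSn x m ^ 2) * (1 - m * jacobiSn x m ^ 2)) ∧
      ∀ r : ℝ, r ^ 2 ≤ 1 → m * r ^ 2 < 1 → ∃ x, jacobiSn x m = r ∧ 0 ≤ g x := by
  rcases h1.eq_or_lt with rfl | h1
  · have htanh : ∀ x, HasDerivAt Real.tanh (1 - Real.tanh x ^ 2) x := by
      intro x
      have hc := (Real.cosh_pos x).ne'
      have h := (Real.hasDerivAt_sinh x).div (Real.hasDerivAt_cosh x) hc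
      have he : Real.tanh = Real.sinh / Real.cosh := funext fun y => Real.tanh_eq_sinh_div_cosh y
      rw [he]
      refine h.congr_deriv ?_
      simp only [Pi.div_apply]
      field_simp
    refine ⟨fun x => 1 - Real.tanh x ^ 2, ?_, ?_, ?_, ?_⟩
    · simpa [jacobiSn] using htanh
    · intro x
      refine (((htanh x).pow 2).const_sub 1).congr_deriv ?_
      simp [jacobiSn]
      ring
    · intro x
      simp [jacobiSn]
      ring
    · intro r _ hr
      have hr' : r ∈ Set.Ioo (-1 : ℝ) 1 := by
        constructor <;> nlinarith
      refine ⟨Real.artanh r, ?_, ?_⟩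
      · simp [jacobiSn, Real.tanh_artanh hr']
      · simp only [Real.tanh_artanh hr']
        linarith
  · have hsn : ∀ x, jacobiSn x m = Real.sin (jacobiAm x m) := fun x => by
      simp [jacobiSn, h1.ne]
    have ham := hasDerivAt_jacobiAm h0 h1
    have hs : ∀ x, HasDerivAt (fun x => Real.sin (jacobiAm x m)) _ x := fun x => (ham x).sin
    refine ⟨fun x => Real.cos (jacobiAm x m) * Real.sqrt (1 - m * Real.sin (jacobiAm x m) ^ 2),
      ?_, ?_, ?_, ?_⟩
    · simpa only [hsn] using hs
    · intro x
      have hpos := one_sub_mul_sin_sq_pos h1 (jacobiAm x m)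
      have hd := (ham x).cos.mul (((((hs x).pow 2).const_mul m).const_sub 1).sqrt hpos.ne')
      refine hd.congr_deriv ?_
      have hq := Real.sq_sqrt hpos.le
      have hsq := Real.sqrt_pos.2 hpos
      have hcs := Real.sin_sq_add_cos_sq (jacobiAm x m)
      simp only [hsn, Pi.pow_apply]
      set q := Real.sqrt (1 - m * Real.sin (jacobiAm x m) ^ 2)
      set a := Real.sin (jacobiAm x m)
      set b := Real.cos (jacobiAm x m)
      have hb : b ^ 2 = 1 - a ^ 2 := by linarith
      field_simp
      norm_num
      rw [hq, hb]
      ring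
    · intro x
      have hpos := one_sub_mul_sin_sq_pos h1 (jacobiAm x m)
      simp only [hsn, mul_pow, Real.sq_sqrt hpos.le]
      rw [Real.cos_sq']
    · intro r hr _
      have hr' := abs_le.1 ((sq_le_one_iff_abs_le_one r).1 hr)
      refine ⟨ellipticF (Real.arcsin r) m, ?_, ?_⟩
      · rw [hsn, jacobiAm_ellipticF h1, Real.sin_arcsin hr'.1 hr'.2]
      · simp only [jacobiAm_ellipticF h1, Real.cos_arcsin]
        positivity

end JacobiFunctions

/-! ### Uniqueness for the second-order curvature equation. -/

section ScalarEquation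

variable {a b : ℝ}

lemma eq_of_hasDerivWithinAt_zero {f : ℝ → ℝ}
    (hf : ∀ x ∈ Set.Icc a b, HasDerivWithinAt f 0 (Set.Icc a b) x)
    {x y : ℝ} (hx : x ∈ Set.Icc a b) (hy : y ∈ Set.Icc a b) : f x = f y := by
  have h := (convex_Icc a b).norm_image_sub_le_of_norm_hasDerivWithin_le (C := 0) hf
    (fun z _ => by simp) hy hx
  simpa [sub_eq_zero] using h

/-- A solution of `d'' = h d` with `h` continuous on a compact interval that vanishes to first order
at a point is zero. -/
lemma eq_zero_of_linear_second_order {d p h : ℝ → ℝ} (hh : ContinuousOn h (Set.Icc a b))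
    (hd : ∀ x ∈ Set.Icc a b, HasDerivWithinAt d (p x) (Set.Icc a b) x)
    (hp : ∀ x ∈ Set.Icc a b, HasDerivWithinAt p (h x * d x) (Set.Icc a b) x)
    {x₀ : ℝ} (hx₀ : x₀ ∈ Set.Icc a b) (hd₀ : d x₀ = 0) (hp₀ : p x₀ = 0) :
    ∀ x ∈ Set.Icc a b, d x = 0 := by
  -- Gronwall for the energy d² + p²: its derivative is at most 1 + M times itself in absolute
  -- value. The weights exp(∓(1 + M)x) make it antitone for use to the right of x₀, monotone for use
  -- to the left.
  obtain ⟨M, hM⟩ := isCompact_Icc.exists_bound_of_continuousOn hh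
  have hE (k : ℝ) : ∀ x ∈ Set.Icc a b,
      HasDerivWithinAt (fun y => (d y ^ 2 + p y ^ 2) * Real.exp (k * y))
        ((2 * (1 + h x) * (d x * p x) + k * (d x ^ 2 + p x ^ 2)) * Real.exp (k * x))
        (Set.Icc a b) x := by
    intro x hx
    have he : HasDerivWithinAt (fun y => Real.exp (k * y)) (Real.exp (k * x) * (k * 1))
        (Set.Icc a b) x := ((hasDerivAt_id x).const_mul k).exp.hasDerivWithinAt
    refine ((((hd x hx).pow 2).add ((hp x hx).pow 2)).mul he).congr_deriv ?_
    simp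
    ring
  have hbound : ∀ x ∈ Set.Icc a b,
      |2 * (1 + h x) * (d x * p x)| ≤ (1 + M) * (d x ^ 2 + p x ^ 2) := by
    intro x hx
    have h1 : |1 + h x| ≤ 1 + M :=
      (abs_add_le _ _).trans (by simpa using hM x hx)
    have h2 : |2 * (d x * p x)| ≤ d x ^ 2 + p x ^ 2 :=
      abs_le.2 ⟨by nlinarith [sq_nonneg (d x + p x)], by nlinarith [sq_nonneg (d x - p x)]⟩
    calc |2 * (1 + h x) * (d x * p x)| = |1 + h x| * |2 * (d x * p x)| := by
          rw [← abs_mul]; ring_nf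
      _ ≤ _ := mul_le_mul h1 h2 (abs_nonneg _) ((abs_nonneg _).trans h1)
  have hcont (k : ℝ) : ContinuousOn (fun y => (d y ^ 2 + p y ^ 2) * Real.exp (k * y))
      (Set.Icc a b) := fun x hx => (hE k x hx).continuousWithinAt
  have hderiv (k : ℝ) : ∀ x ∈ interior (Set.Icc a b),
      HasDerivWithinAt (fun y => (d y ^ 2 + p y ^ 2) * Real.exp (k * y))
        ((2 * (1 + h x) * (d x * p x) + k * (d x ^ 2 + p x ^ 2)) * Real.exp (k * x))
        (interior (Set.Icc a b)) x :=
    fun x hx => (hE k x (interior_subset hx)).mono interior_subset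
  have hanti : AntitoneOn (fun y => (d y ^ 2 + p y ^ 2) * Real.exp (-(1 + M) * y))
      (Set.Icc a b) := by
    refine antitoneOn_of_hasDerivWithinAt_nonpos (convex_Icc a b) (hcont _) (hderiv _) ?_
    intro x hx
    have := (abs_le.1 (hbound x (interior_subset hx))).2
    exact mul_nonpos_of_nonpos_of_nonneg (by linarith) (Real.exp_pos _).le
  have hmono : MonotoneOn (fun y => (d y ^ 2 + p y ^ 2) * Real.exp ((1 + M) * y))
      (Set.Icc a b) := by
    refine monotoneOn_of_hasDerivWithinAt_nonneg (convex_Icc a b) (hcont _) (hderiv _) ?_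
    intro x hx
    have := (abs_le.1 (hbound x (interior_subset hx))).1
    exact mul_nonneg (by linarith) (Real.exp_pos _).le
  intro x hx
  have key : d x ^ 2 + p x ^ 2 ≤ 0 := by
    rcases le_total x₀ x with hle | hle
    · have := hanti hx₀ hx hle
      simp only [hd₀, hp₀] at this
      exact nonpos_of_mul_nonpos_left (by simpa using this) (Real.exp_pos (-(1 + M) * x))
    · have := hmono hx hx₀ hle
      simp only [hd₀, hp₀] at this
      exact nonpos_of_mul_nonpos_left (by simpa using this) (Real.exp_pos ((1 + M) * x))
  nlinarith [sq_nonneg (d x), sq_nonneg (p x)]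

/-- Solutions of `u'' = q - (3/2) u² + 2 lam u` are determined by their initial data at a point. -/
lemma eqOn_of_quadratic_second_order {lam q : ℝ} {u v U V : ℝ → ℝ}
    (hu : ∀ x ∈ Set.Icc a b, HasDerivWithinAt u (v x) (Set.Icc a b) x)
    (hv : ∀ x ∈ Set.Icc a b,
      HasDerivWithinAt v (q - 3 / 2 * u x ^ 2 + 2 * lam * u x) (Set.Icc a b) x)
    (hU : ∀ x ∈ Set.Icc a b, HasDerivWithinAt U (V x) (Set.Icc a b) x)
    (hV : ∀ x ∈ Set.Icc a b,
      HasDerivWithinAt V (q - 3 / 2 * U x ^ 2 + 2 * lam * U x) (Set.Icc a b) x)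
    {x₀ : ℝ} (hx₀ : x₀ ∈ Set.Icc a b) (h0 : u x₀ = U x₀) (h1 : v x₀ = V x₀) :
    Set.EqOn u U (Set.Icc a b) := by
  have hcu : ContinuousOn u (Set.Icc a b) := fun x hx => (hu x hx).continuousWithinAt
  have hcU : ContinuousOn U (Set.Icc a b) := fun x hx => (hU x hx).continuousWithinAt
  intro x hx
  -- As u² - U² = (u + U)(u - U), the difference solves a linear equation with continuous
  -- coefficient.
  refine sub_eq_zero.1 (eq_zero_of_linear_second_order (d := fun y => u y - U y)
    (p := fun y => v y - V y) (h := fun y => -(3 / 2) * (u y + U y) + 2 * lam)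
    (by fun_prop) (fun y hy => (hu y hy).sub (hU y hy)) (fun y hy => ?_) hx₀
    (sub_eq_zero.2 h0) (sub_eq_zero.2 h1) x hx)
  refine ((hv y hy).sub (hV y hy)).congr_deriv ?_
  ring

end ScalarEquation

/-! ### First integrals of an elastica in space. -/

section CurveInvariants

lemma hasDerivWithinAt_arcIter {n : ℕ} {a b : ℝ} {γ : ℝ → EuclideanSpace ℝ (Fin n)}
    (hγ : IsSmoothCurve a b γ) (harc : IsArclength a b γ) (k : ℕ) :
    ∀ x ∈ Set.Icc a b,
      HasDerivWithinAt (arcIter a b γ k) (arcIter a b γ (k + 1) x) (Set.Icc a b) x := by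
  have hstep : ∀ k, ∀ x ∈ Set.Icc a b,
      arcIter a b γ (k + 1) x = derivWithin (arcIter a b γ k) (Set.Icc a b) x := by
    intro k x hx
    rw [arcIter, Function.iterate_succ_apply', arcDeriv, harc x hx, inv_one, one_smul, arcIter]
  have hsmooth : ContDiffOn ℝ ∞ (arcIter a b γ k) (Set.Icc a b) := by
    induction k with
    | zero => exact hγ.contDiffOn
    | succ k ih =>
      exact (ih.derivWithin (uniqueDiffOn_Icc hγ.lt) (by simp)).congr (hstep k)
  intro x hx
  rw [hstep k x hx]
  exact ((hsmooth.differentiableOn (by simp)) x hx).hasDerivWithinAt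

lemma deriv_eq_zero_of_eq_const {a b : ℝ} (hab : a < b) {f : ℝ → ℝ} {C f' x : ℝ}
    (hf : ∀ y ∈ Set.Icc a b, f y = C) (hx : x ∈ Set.Icc a b)
    (hd : HasDerivWithinAt f f' (Set.Icc a b) x) : f' = 0 :=
  (uniqueDiffOn_Icc hab x hx).eq_deriv _ hd
    ((hasDerivWithinAt_const x _ C).congr hf (hf x hx))

/-- Otherwise the tangent is constant and γ is affine, so its image is a segment. -/
lemma exists_curvature_pos {n : ℕ} {a b : ℝ} {γ : ℝ → EuclideanSpace ℝ (Fin n)}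
    (hγ : IsSmoothCurve a b γ) (harc : IsArclength a b γ) (hseg : ¬ IsStraightSegment a b γ) :
    ∃ x ∈ Set.Icc a b, 0 < ‖curvature a b γ x‖ ^ 2 := by
  by_contra! hcon
  have hK : ∀ x ∈ Set.Icc a b, arcIter a b γ 2 x = 0 := fun x hx => by
    have h : ‖arcIter a b γ 2 x‖ ^ 2 ≤ 0 := hcon x hx
    simpa using (pow_eq_zero_iff two_ne_zero).1 (le_antisymm h (sq_nonneg _))
  have ha : a ∈ Set.Icc a b := Set.left_mem_Icc.2 hγ.lt.le
  have hT : ∀ x ∈ Set.Icc a b, arcIter a b γ 1 x = arcIter a b γ 1 a := fun x hx => by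
    have h := (convex_Icc a b).norm_image_sub_le_of_norm_hasDerivWithin_le (C := 0)
      (hasDerivWithinAt_arcIter hγ harc 1) (fun z hz => by simp [hK z hz]) ha hx
    simpa [sub_eq_zero] using h
  have hline : ∀ x ∈ Set.Icc a b, γ x = γ a + (x - a) • arcIter a b γ 1 a := fun x hx => by
    have h := (convex_Icc a b).norm_image_sub_le_of_norm_hasDerivWithin_le (C := 0)
      (f := fun y => γ y - (y - a) • arcIter a b γ 1 a) (f' := fun _ => 0) (fun y hy => by
        refine ((hasDerivWithinAt_arcIter hγ harc 0 y hy).sub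
          ((((hasDerivAt_id y).sub_const a).smul_const
            (arcIter a b γ 1 a)).hasDerivWithinAt)).congr_deriv ?_
        simp [hT y hy]) (fun z hz => by simp) ha hx
    simp only [zero_mul, norm_le_zero_iff, sub_self, zero_smul, sub_zero] at h
    rw [sub_eq_zero, sub_eq_iff_eq_add] at h
    exact h
  refine hseg ⟨γ a, γ b, ?_⟩
  set T := arcIter a b γ 1 a
  have hb := hline b (Set.right_mem_Icc.2 hγ.lt.le)
  have hba : 0 < b - a := sub_pos.2 hγ.lt
  rw [segment_eq_image']
  ext z
  constructor
  · rintro ⟨x, hx, rfl⟩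
    refine ⟨(x - a) / (b - a), ⟨div_nonneg (sub_nonneg.2 hx.1) hba.le,
      (div_le_one hba).2 (by linarith [hx.2])⟩, ?_⟩
    simp only [hline x hx, hb, add_sub_cancel_left, smul_smul, div_mul_cancel₀ _ hba.ne']
  · rintro ⟨t, ht, rfl⟩
    have hx : a + t * (b - a) ∈ Set.Icc a b := by
      constructor <;> nlinarith [ht.1, ht.2]
    refine ⟨_, hx, ?_⟩
    simp only [hline _ hx, hb, add_sub_cancel_left, smul_smul]

lemma hasDerivWithinAt_apply {n : ℕ} {f : ℝ → EuclideanSpace ℝ (Fin n)}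
    {f' : EuclideanSpace ℝ (Fin n)} {s : Set ℝ} {x : ℝ} (h : HasDerivWithinAt f f' s x)
    (i : Fin n) : HasDerivWithinAt (fun y => f y i) (f' i) s x :=
  (EuclideanSpace.proj (𝕜 := ℝ) i).hasFDerivAt.comp_hasDerivWithinAt x h

/-- The Gram determinant of the three columns. -/
lemma detFrame_sq (a b : ℝ) (γ : ℝ → EuclideanSpace ℝ (Fin 3)) (x : ℝ) :
    detFrame a b γ x ^ 2 =
      inner ℝ (arcIter a b γ 1 x) (arcIter a b γ 1 x) *
          (inner ℝ (arcIter a b γ 2 x) (arcIter a b γ 2 x) *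
            inner ℝ (arcIter a b γ 3 x) (arcIter a b γ 3 x) -
          inner ℝ (arcIter a b γ 2 x) (arcIter a b γ 3 x) ^ 2) -
        inner ℝ (arcIter a b γ 1 x) (arcIter a b γ 2 x) *
          (inner ℝ (arcIter a b γ 1 x) (arcIter a b γ 2 x) *
            inner ℝ (arcIter a b γ 3 x) (arcIter a b γ 3 x) -
          inner ℝ (arcIter a b γ 2 x) (arcIter a b γ 3 x) *
            inner ℝ (arcIter a b γ 1 x) (arcIter a b γ 3 x)) +
        inner ℝ (arcIter a b γ 1 x) (arcIter a b γ 3 x) *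
          (inner ℝ (arcIter a b γ 1 x) (arcIter a b γ 2 x) *
            inner ℝ (arcIter a b γ 2 x) (arcIter a b γ 3 x) -
          inner ℝ (arcIter a b γ 2 x) (arcIter a b γ 2 x) *
            inner ℝ (arcIter a b γ 1 x) (arcIter a b γ 3 x)) := by
  simp only [detFrame, Matrix.det_fin_three, Matrix.of_apply, PiLp.inner_apply,
    Fin.sum_univ_three, RCLike.inner_apply, conj_trivial, Fin.val_zero, Fin.val_one, Fin.val_two,
    zero_add, Nat.reduceAdd]
  ring

variable {lam L : ℝ} {γ : ℝ → EuclideanSpace ℝ (Fin 3)}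

/-- Differentiating T or K repeats a column, and the elastica equation puts J' in the span of T and
K. -/
lemma detFrame_eq (hγ : IsElastica lam 0 L γ) (harc : IsArclength 0 L γ) :
    ∀ x ∈ Set.Icc 0 L, detFrame 0 L γ x = detFrame 0 L γ 0 := by
  have h0 : (0 : ℝ) ∈ Set.Icc 0 L := Set.left_mem_Icc.2 hγ.smooth.lt.le
  refine fun x hx => eq_of_hasDerivWithinAt_zero (fun y hy => ?_) hx h0
  have hT := hasDerivWithinAt_apply (hasDerivWithinAt_arcIter hγ.smooth harc 1 y hy)
  have hK := hasDerivWithinAt_apply (hasDerivWithinAt_arcIter hγ.smooth harc 2 y hy)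
  have hJ := hasDerivWithinAt_apply (hasDerivWithinAt_arcIter hγ.smooth harc 3 y hy)
  have heq : ∀ i, arcIter 0 L γ 4 y i =
      -3 * inner ℝ (arcIter 0 L γ 2 y) (arcIter 0 L γ 3 y) * arcIter 0 L γ 1 y i
        + (lam - 3 * ‖arcIter 0 L γ 2 y‖ ^ 2) / 2 * arcIter 0 L γ 2 y i := fun i => by
    have h := congrArg (fun z : EuclideanSpace ℝ (Fin 3) => z i) (hγ.equation y hy)
    simp only [PiLp.add_apply, PiLp.sub_apply, PiLp.smul_apply, smul_eq_mul,
      PiLp.zero_apply] at h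
    linarith
  have hdet : detFrame 0 L γ = fun y =>
      arcIter 0 L γ 1 y 0 * arcIter 0 L γ 2 y 1 * arcIter 0 L γ 3 y 2
        - arcIter 0 L γ 1 y 0 * arcIter 0 L γ 3 y 1 * arcIter 0 L γ 2 y 2
        - arcIter 0 L γ 2 y 0 * arcIter 0 L γ 1 y 1 * arcIter 0 L γ 3 y 2
        + arcIter 0 L γ 2 y 0 * arcIter 0 L γ 3 y 1 * arcIter 0 L γ 1 y 2
        + arcIter 0 L γ 3 y 0 * arcIter 0 L γ 1 y 1 * arcIter 0 L γ 2 y 2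
        - arcIter 0 L γ 3 y 0 * arcIter 0 L γ 2 y 1 * arcIter 0 L γ 1 y 2 := by
    funext z
    simp [detFrame, Matrix.det_fin_three]
  rw [hdet]
  refine ((((((((hT 0).mul (hK 1)).mul (hJ 2)).sub (((hT 0).mul (hJ 1)).mul (hK 2))).sub
    (((hK 0).mul (hT 1)).mul (hJ 2))).add (((hK 0).mul (hJ 1)).mul (hT 2))).add
    (((hJ 0).mul (hT 1)).mul (hK 2))).sub (((hJ 0).mul (hK 1)).mul (hT 2))).congr_deriv ?_
  simp only [Nat.reduceAdd, heq]
  simp only [Pi.mul_apply]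
  ring

/-- The squared curvature of an elastica solves `u'² = -u³ + 2 lam u² + 4 e u - 4 c²`. -/
theorem exists_curvature_equation (hγ : IsElastica lam 0 L γ) (harc : IsArclength 0 L γ) :
    ∃ (e : ℝ) (v : ℝ → ℝ), ∀ x ∈ Set.Icc 0 L,
      HasDerivWithinAt (fun y => ‖curvature 0 L γ y‖ ^ 2) (v x) (Set.Icc 0 L) x ∧
      HasDerivWithinAt v (2 * e - 3 / 2 * (‖curvature 0 L γ x‖ ^ 2) ^ 2
        + 2 * lam * ‖curvature 0 L γ x‖ ^ 2) (Set.Icc 0 L) x ∧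
      v x ^ 2 = -(‖curvature 0 L γ x‖ ^ 2) ^ 3 + 2 * lam * (‖curvature 0 L γ x‖ ^ 2) ^ 2
        + 4 * e * ‖curvature 0 L γ x‖ ^ 2 - 4 * detFrame 0 L γ 0 ^ 2 := by
  have hab := hγ.smooth.lt
  have h0 : (0 : ℝ) ∈ Set.Icc 0 L := Set.left_mem_Icc.2 hab.le
  have hstep := hasDerivWithinAt_arcIter hγ.smooth harc
  have hdet := detFrame_eq hγ harc
  have hgram := detFrame_sq 0 L γ
  have hnT : ∀ x ∈ Set.Icc 0 L, ‖arcIter 0 L γ 1 x‖ = 1 := fun x hx => by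
    have : arcIter 0 L γ 1 x = derivWithin γ (Set.Icc 0 L) x := by
      rw [arcIter, Function.iterate_one, arcDeriv, harc x hx, inv_one, one_smul]
    rw [this, harc x hx]
  have heq := hγ.equation
  simp only [curvature]
  have dT := hstep 1
  have dK := hstep 2
  have dJ := hstep 3
  simp only [Nat.reduceAdd] at dT dK dJ
  set T := arcIter 0 L γ 1
  set K := arcIter 0 L γ 2
  set J := arcIter 0 L γ 3
  set S := arcIter 0 L γ 4
  have hTT : ∀ x ∈ Set.Icc 0 L, inner ℝ (T x) (T x) = (1 : ℝ) := fun x hx => by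
    rw [real_inner_self_eq_norm_sq, hnT x hx, one_pow]
  have hTK : ∀ x ∈ Set.Icc 0 L, inner ℝ (T x) (K x) = (0 : ℝ) := fun x hx => by
    have h := deriv_eq_zero_of_eq_const hab hTT hx ((dT x hx).inner ℝ (dT x hx))
    rw [real_inner_comm (T x) (K x)] at h
    linarith
  have hTJ : ∀ x ∈ Set.Icc 0 L, inner ℝ (T x) (J x) = -‖K x‖ ^ 2 := fun x hx => by
    have h := deriv_eq_zero_of_eq_const hab hTK hx ((dT x hx).inner ℝ (dK x hx))
    rw [real_inner_self_eq_norm_sq] at h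
    linarith
  have heqK : ∀ x ∈ Set.Icc 0 L,
      inner ℝ (K x) (S x) = lam / 2 * ‖K x‖ ^ 2 - 3 / 2 * (‖K x‖ ^ 2) ^ 2 := fun x hx => by
    have h := congrArg (fun z => inner ℝ (K x) z) (heq x hx)
    simp only [inner_add_right, inner_sub_right, inner_smul_right, inner_zero_right] at h
    rw [real_inner_comm (T x) (K x), hTK x hx, real_inner_self_eq_norm_sq] at h
    linarith
  have heqJ : ∀ x ∈ Set.Icc 0 L,
      inner ℝ (J x) (S x) = (lam / 2 + 3 / 2 * ‖K x‖ ^ 2) * inner ℝ (K x) (J x) :=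
    fun x hx => by
    have h := congrArg (fun z => inner ℝ (J x) z) (heq x hx)
    simp only [inner_add_right, inner_sub_right, inner_smul_right, inner_zero_right] at h
    rw [real_inner_comm (T x) (J x), hTJ x hx, real_inner_comm (K x) (J x)] at h
    linarith
  have du : ∀ x ∈ Set.Icc 0 L, HasDerivWithinAt (fun y => ‖K y‖ ^ 2)
      (2 * inner ℝ (K x) (J x)) (Set.Icc 0 L) x := fun x hx => (dK x hx).norm_sq
  -- By `heqJ`, (|J|²)' = (lam/2 + (3/2)u)u', an exact derivative; the constant becomes e.
  have hJJ : ∀ x ∈ Set.Icc 0 L, ‖J x‖ ^ 2 - 3 / 4 * (‖K x‖ ^ 2) ^ 2 - lam / 2 * ‖K x‖ ^ 2 =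
      ‖J 0‖ ^ 2 - 3 / 4 * (‖K 0‖ ^ 2) ^ 2 - lam / 2 * ‖K 0‖ ^ 2 := fun x hx => by
    refine eq_of_hasDerivWithinAt_zero (f := fun y =>
      ‖J y‖ ^ 2 - 3 / 4 * (‖K y‖ ^ 2) ^ 2 - lam / 2 * ‖K y‖ ^ 2) (fun y hy => ?_) hx h0
    refine (((dJ y hy).norm_sq.sub (((du y hy).pow 2).const_mul (3 / 4))).sub
      ((du y hy).const_mul (lam / 2))).congr_deriv ?_
    rw [heqJ y hy]
    simp
    ring
  refine ⟨‖J 0‖ ^ 2 - 3 / 4 * (‖K 0‖ ^ 2) ^ 2 - lam / 2 * ‖K 0‖ ^ 2,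
    fun x => 2 * inner ℝ (K x) (J x), fun x hx => ⟨du x hx, ?_, ?_⟩⟩
  · refine (((dK x hx).inner ℝ (dJ x hx)).const_mul 2).congr_deriv ?_
    rw [heqK x hx, real_inner_self_eq_norm_sq, ← hJJ x hx]
    ring
  · rw [← hdet x hx, hgram x, hTT x hx, hTK x hx, hTJ x hx, ← hJJ x hx]
    simp only [real_inner_self_eq_norm_sq]
    ring

end CurveInvariants

/-! ### Real roots of the cubic. -/

section CubicRoots

/-- A cubic `-t³ + 2 lam t² + 4 e t - 4 c²` that is nonnegative at some `u > 0` has three real roots,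
which interlace with `0` and `u`. -/
lemma exists_ordered_roots {lam e c u : ℝ} (hu : 0 < u)
    (hP : 0 ≤ -u ^ 3 + 2 * lam * u ^ 2 + 4 * e * u - 4 * c ^ 2) :
    ∃ x y z : ℝ, x ≤ 0 ∧ 0 ≤ y ∧ y ≤ u ∧ u ≤ z ∧ 2 * lam = x + y + z ∧
      4 * e = -(x * y + x * z + y * z) ∧ 4 * c ^ 2 = -(x * y * z) := by
  have sorted : ∀ x y z : ℝ, x ≤ y → y ≤ z → u ≤ z → 2 * lam = x + y + z →
      4 * e = -(x * y + x * z + y * z) → 4 * c ^ 2 = -(x * y * z) →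
      x ≤ 0 ∧ 0 ≤ y ∧ y ≤ u := by
    intro x y z hxy hyz huz h1 h2 h3
    have hz : 0 < z := hu.trans_le huz
    have hprod : x * y ≤ 0 := by
      by_contra! hcon
      nlinarith [mul_pos hcon hz, sq_nonneg c]
    have hx : x ≤ 0 := by
      by_contra! hcon
      exact absurd hprod (not_le.2 (mul_pos hcon (hcon.trans_le hxy)))
    have hy : 0 ≤ y := by
      by_contra! hcon
      exact absurd hprod (not_le.2 (mul_pos_of_neg_of_neg (hxy.trans_lt hcon) hcon))
    refine ⟨hx, hy, ?_⟩
    by_contra! hcon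
    -- If u < y, the factored cubic would be negative at u.
    have hfac : (u - x) * ((y - u) * (z - u)) ≤ 0 := by
      have : -((u - x) * ((y - u) * (z - u))) =
          -u ^ 3 + 2 * lam * u ^ 2 + 4 * e * u - 4 * c ^ 2 := by
        rw [h1, h2, h3]; ring
      linarith
    exact absurd hfac (not_le.2 (mul_pos (by linarith)
      (mul_pos (by linarith) (by linarith))))
  set P : ℝ → ℝ := fun t => -t ^ 3 + 2 * lam * t ^ 2 + 4 * e * t - 4 * c ^ 2 with hPdef
  have hcont : Continuous P := by fun_prop
  -- Beyond M the leading term dominates the sum of the others.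
  set M : ℝ := 1 + 2 * |lam| + 4 * |e| + 4 * c ^ 2 with hM
  have hlam := abs_nonneg lam
  have he := abs_nonneg e
  have hbig : ∀ t, M ≤ t → 2 * |lam| * t ^ 2 + 4 * |e| * t + 4 * c ^ 2 ≤ t ^ 3 := by
    intro t ht
    have h1 : 1 ≤ t := by nlinarith [sq_nonneg c]
    have h2 : t ≤ t ^ 2 := by nlinarith
    have h3 : M * t ^ 2 ≤ t * t ^ 2 := by gcongr
    have h4 : |e| * t ≤ |e| * t ^ 2 := by gcongr
    have h5 : c ^ 2 * 1 ≤ c ^ 2 * t ^ 2 := by gcongr; linarith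
    rw [hM] at h3
    nlinarith
  have hMpos : 0 < M := by positivity
  -- P(0) = -4c² ≤ 0 gives a root in [-M, 0], and P(u) ≥ 0 one in [u, M + u]. The third root is then
  -- real, being fixed by the sum.
  obtain ⟨p, hp, hPp⟩ : ∃ p ∈ Set.Icc (-M) 0, P p = 0 := by
    have hmem : (0 : ℝ) ∈ Set.Icc (P 0) (P (-M)) := by
      constructor
      · simp only [hPdef]; nlinarith [sq_nonneg c]
      · have h := hbig M le_rfl
        simp only [hPdef]
        nlinarith [neg_abs_le lam, le_abs_self e, sq_nonneg M,
          mul_nonneg (sub_nonneg.2 (neg_abs_le lam)) (sq_nonneg M),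
          mul_nonneg (sub_nonneg.2 (le_abs_self e)) hMpos.le]
    exact intermediate_value_Icc' (by linarith) hcont.continuousOn hmem
  obtain ⟨r, hr, hPr⟩ : ∃ r ∈ Set.Icc u (M + u), P r = 0 := by
    have hmem : (0 : ℝ) ∈ Set.Icc (P (M + u)) (P u) := by
      refine ⟨?_, hP⟩
      have h := hbig (M + u) (by linarith)
      simp only [hPdef]
      nlinarith [mul_nonneg (sub_nonneg.2 (le_abs_self lam)) (sq_nonneg (M + u)),
        mul_nonneg (sub_nonneg.2 (le_abs_self e)) (add_pos hMpos hu).le]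
    exact intermediate_value_Icc' (by linarith) hcont.continuousOn hmem
  have hpr : p < r := by linarith [hp.2, hr.1]
  obtain ⟨q, hq⟩ : ∃ q, 2 * lam = p + q + r := ⟨2 * lam - p - r, by ring⟩
  simp only [hPdef, hq] at hPp hPr
  have hV2 : 4 * e = -(p * q + p * r + q * r) := by
    have : (r - p) * (4 * e + (p * q + p * r + q * r)) = 0 := by linear_combination hPr - hPp
    rcases mul_eq_zero.1 this with h | h <;> linarith
  have hV3 : 4 * c ^ 2 = -(p * q * r) := by
    rw [hV2] at hPp
    linear_combination -hPp
  rcases le_total q p with h1 | h1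
  · obtain ⟨h2, h3, h4⟩ := sorted q p r h1 hpr.le hr.1 (by linarith) (by linarith) (by linarith)
    exact ⟨q, p, r, h2, h3, h4, hr.1, by linarith, by linarith, by linarith⟩
  · rcases le_total q r with h5 | h5
    · obtain ⟨h2, h3, h4⟩ := sorted p q r h1 h5 hr.1 hq hV2 hV3
      exact ⟨p, q, r, h2, h3, h4, hr.1, hq, hV2, hV3⟩
    · obtain ⟨h2, h3, h4⟩ := sorted p r q hpr.le h5 (hr.1.trans h5) (by linarith) (by linarith)
        (by linarith)
      exact ⟨p, r, q, h2, h3, h4, hr.1.trans h5, by linarith, by linarith, by linarith⟩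

/-- Ordered triples are determined by their elementary symmetric functions. -/
lemma ordered_roots_unique {x y z x' y' z' : ℝ} (hxy : x ≤ y) (hyz : y ≤ z) (hxy' : x' ≤ y')
    (hyz' : y' ≤ z') (h1 : x + y + z = x' + y' + z')
    (h2 : x * y + x * z + y * z = x' * y' + x' * z' + y' * z')
    (h3 : x * y * z = x' * y' * z') : x = x' ∧ y = y' ∧ z = z' := by
  have hpoly : ∀ t, (t - x) * ((t - y) * (t - z)) = (t - x') * ((t - y') * (t - z')) := fun t => by
    linear_combination -t ^ 2 * h1 + t * h2 - h3
  -- At the larger of z and z', one cubic vanishes while the other is positive; the smallest roots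
  -- are compared likewise.
  have hz : z = z' := by
    rcases lt_trichotomy z z' with h | h | h
    · have := hpoly z'
      rw [sub_self, mul_zero, mul_zero] at this
      exact absurd this (mul_pos (by linarith) (mul_pos (by linarith) (by linarith))).ne'
    · exact h
    · have := hpoly z
      rw [sub_self, mul_zero, mul_zero] at this
      exact absurd this.symm (mul_pos (by linarith) (mul_pos (by linarith) (by linarith))).ne'
  have hx : x = x' := by
    rcases lt_trichotomy x x' with h | h | h
    · have := hpoly x
      rw [sub_self, zero_mul] at this
      exact absurd this.symm (mul_neg_of_neg_of_pos (by linarith)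
        (mul_pos_of_neg_of_neg (by linarith) (by linarith))).ne
    · exact h
    · have := hpoly x'
      rw [sub_self, zero_mul] at this
      exact absurd this (mul_neg_of_neg_of_pos (by linarith)
        (mul_pos_of_neg_of_neg (by linarith) (by linarith))).ne
  exact ⟨hx, by linarith, hz⟩

end CubicRoots

/-! ### The sn profile and its parameters. -/

section CurvatureProfile

/-- The function `A² (1 - (m / w) sn²(A s / (2 √w) + s₀, m))`. -/
noncomputable def curvatureProfile (m w A s₀ s : ℝ) : ℝ :=
  A ^ 2 * (1 - m / w * jacobiSn (A / (2 * Real.sqrt w) * s + s₀) m ^ 2)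

variable {m w A : ℝ}

/-- With U the profile and σ = sn, the root differences are A² - U = A²(m/w)σ², U - A²(w - m)/w =
A²(m/w)(1 - σ²) and U - A²(w - 1)/w = (A²/w)(1 - mσ²). Their product is V², by the equation for the
derivative of sn. -/
lemma curvatureProfile_equation {g : ℝ → ℝ} (hw : 0 < w)
    (hsn : ∀ x, HasDerivAt (fun x => jacobiSn x m) (g x) x)
    (hg : ∀ x, HasDerivAt g (-(1 + m) * jacobiSn x m + 2 * m * jacobiSn x m ^ 3) x)
    (hsq : ∀ x, g x ^ 2 = (1 - jacobiSn x m ^ 2) * (1 - m * jacobiSn x m ^ 2))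
    (s₀ : ℝ) : ∃ V : ℝ → ℝ,
      (∀ s, V s = -(A ^ 2 * (m / w) * (A / Real.sqrt w)) *
        (jacobiSn (A / (2 * Real.sqrt w) * s + s₀) m * g (A / (2 * Real.sqrt w) * s + s₀))) ∧
      ∀ s, HasDerivAt (curvatureProfile m w A s₀) (V s) s ∧
        HasDerivAt V (-(A ^ 4 / w ^ 2 * ((w - 1) * (w - m) + w * (w - 1) + w * (w - m))) / 2
          - 3 / 2 * curvatureProfile m w A s₀ s ^ 2
          + 2 * (A ^ 2 / (2 * w) * (3 * w - m - 1)) * curvatureProfile m w A s₀ s) s ∧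
        V s ^ 2 = -curvatureProfile m w A s₀ s ^ 3
          + 2 * (A ^ 2 / (2 * w) * (3 * w - m - 1)) * curvatureProfile m w A s₀ s ^ 2
          + -(A ^ 4 / w ^ 2 * ((w - 1) * (w - m) + w * (w - 1) + w * (w - m))) *
            curvatureProfile m w A s₀ s - A ^ 6 / w ^ 2 * (1 - w) * (w - m) := by
  refine ⟨_, fun _ => rfl, fun s => ?_⟩
  obtain ⟨k, hk, hkw⟩ : ∃ k, 0 < k ∧ w = k ^ 2 :=
    ⟨Real.sqrt w, Real.sqrt_pos.2 hw, (Real.sq_sqrt hw.le).symm⟩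
  subst hkw
  simp only [Real.sqrt_sq hk.le]
  have hlin : HasDerivAt (fun s => A / (2 * k) * s + s₀) (A / (2 * k)) s := by
    simpa using ((hasDerivAt_id s).const_mul (A / (2 * k))).add_const s₀
  have hsn' : HasDerivAt (fun s => jacobiSn (A / (2 * k) * s + s₀) m) _ s :=
    (hsn _).comp s hlin
  have hg' : HasDerivAt (fun s => g (A / (2 * k) * s + s₀)) _ s := (hg _).comp s hlin
  have hgs := hsq (A / (2 * k) * s + s₀)
  have hprof : curvatureProfile m (k ^ 2) A s₀ =
      fun s => A ^ 2 * (1 - m / k ^ 2 * jacobiSn (A / (2 * k) * s + s₀) m ^ 2) := by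
    funext s
    rw [curvatureProfile, Real.sqrt_sq hk.le]
  rw [hprof]
  refine ⟨?_, ?_, ?_⟩
  · refine ((((hsn'.pow 2).const_mul (m / k ^ 2)).const_sub 1).const_mul (A ^ 2)).congr_deriv ?_
    simp
    field_simp
  · refine ((hsn'.mul hg').const_mul _).congr_deriv ?_
    beta_reduce
    generalize jacobiSn (A / (2 * k) * s + s₀) m = σ at *
    generalize g (A / (2 * k) * s + s₀) = τ at *
    have : τ * (A / (2 * k)) * τ = τ ^ 2 * (A / (2 * k)) := by ring
    rw [this, hgs]
    field_simp
    ring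
  · simp only [mul_pow, neg_sq, hgs]
    field_simp
    ring

/-- The hypotheses equate the symmetric functions of the two root triples. The constraints on m and
w order each triple, so the roots agree; the largest gives A, the smallest w, the middle one m. -/
lemma eq_params_of_eq_roots {m' w' A' : ℝ} (hw : 0 < w) (hA : 0 < A) (hmw : m ≤ w) (hm : 0 ≤ m)
    (hw1 : w ≤ 1) (hw' : 0 < w') (hA' : 0 < A') (hmw' : m' ≤ w') (hm' : 0 ≤ m') (hw1' : w' ≤ 1)
    (h1 : A ^ 2 / (2 * w) * (3 * w - m - 1) = A' ^ 2 / (2 * w') * (3 * w' - m' - 1))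
    (h2 : A ^ 4 / w ^ 2 * ((w - 1) * (w - m) + w * (w - 1) + w * (w - m)) =
      A' ^ 4 / w' ^ 2 * ((w' - 1) * (w' - m') + w' * (w' - 1) + w' * (w' - m')))
    (h3 : A ^ 6 / w ^ 2 * (1 - w) * (w - m) = A' ^ 6 / w' ^ 2 * (1 - w') * (w' - m')) :
    m = m' ∧ w = w' ∧ A = A' := by
  have hle : ∀ {m w A : ℝ}, 0 < w → 0 < A → m ≤ w → 0 ≤ m → w ≤ 1 →
      A ^ 2 / w * (w - 1) ≤ A ^ 2 / w * (w - m) ∧ A ^ 2 / w * (w - m) ≤ A ^ 2 := by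
    intro m w A hw hA hmw hm hw1
    constructor
    · gcongr
      linarith
    · rw [div_mul_eq_mul_div, div_le_iff₀ hw]
      gcongr
      linarith
  have hsum : ∀ {m w A : ℝ}, 0 < w → A ^ 2 / w * (w - 1) + A ^ 2 / w * (w - m) + A ^ 2 =
      2 * (A ^ 2 / (2 * w) * (3 * w - m - 1)) := by
    intro m w A hw; field_simp; ring
  have hsum2 : ∀ {m w A : ℝ}, 0 < w → A ^ 2 / w * (w - 1) * (A ^ 2 / w * (w - m)) +
      A ^ 2 / w * (w - 1) * A ^ 2 + A ^ 2 / w * (w - m) * A ^ 2 =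
      A ^ 4 / w ^ 2 * ((w - 1) * (w - m) + w * (w - 1) + w * (w - m)) := by
    intro m w A hw; field_simp
  have hprod : ∀ {m w A : ℝ}, 0 < w → A ^ 2 / w * (w - 1) * (A ^ 2 / w * (w - m)) * A ^ 2 =
      -(A ^ 6 / w ^ 2 * (1 - w) * (w - m)) := by
    intro m w A hw; field_simp; ring
  obtain ⟨e1, e2, e3⟩ := ordered_roots_unique (hle hw hA hmw hm hw1).1 (hle hw hA hmw hm hw1).2
    (hle hw' hA' hmw' hm' hw1').1 (hle hw' hA' hmw' hm' hw1').2
    (by rw [hsum hw, hsum hw', h1]) (by rw [hsum2 hw, hsum2 hw', h2])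
    (by rw [hprod hw, hprod hw', h3])
  have hAA : A = A' := by
    rwa [pow_left_inj₀ hA.le hA'.le two_ne_zero] at e3
  subst hAA
  have hww : w = w' := by
    field_simp at e1
    linarith
  subst hww
  refine ⟨?_, rfl, rfl⟩
  have : A ^ 2 / w ≠ 0 := by positivity
  have := mul_left_cancel₀ this e2
  linarith

/-- A nonnegative solution of the curvature equation is a `curvatureProfile`. -/
theorem exists_curvatureProfile {a b lam e c : ℝ} {u v : ℝ → ℝ}
    (hu : ∀ x ∈ Set.Icc a b, HasDerivWithinAt u (v x) (Set.Icc a b) x)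
    (hv : ∀ x ∈ Set.Icc a b,
      HasDerivWithinAt v (2 * e - 3 / 2 * u x ^ 2 + 2 * lam * u x) (Set.Icc a b) x)
    (hsq : ∀ x ∈ Set.Icc a b,
      v x ^ 2 = -u x ^ 3 + 2 * lam * u x ^ 2 + 4 * e * u x - 4 * c ^ 2)
    {x₀ : ℝ} (hx₀ : x₀ ∈ Set.Icc a b) (hpos : 0 < u x₀) :
    ∃ m w A s₀ : ℝ, (0 ≤ m ∧ m ≤ w ∧ w ≤ 1 ∧ 0 < w ∧ 0 < A) ∧
      (∀ s ∈ Set.Icc a b, u s = curvatureProfile m w A s₀ s) ∧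
      lam = A ^ 2 / (2 * w) * (3 * w - m - 1) ∧
      4 * c ^ 2 = A ^ 6 / w ^ 2 * (1 - w) * (w - m) := by
  obtain ⟨x, y, z, hx, hy, hyu, huz, h1, h2, h3⟩ :=
    exists_ordered_roots hpos ((sq_nonneg _).trans_eq (hsq x₀ hx₀))
  have hz : 0 < z := hpos.trans_le huz
  have hzx : 0 < z - x := by linarith
  obtain ⟨A, hA, hAz⟩ : ∃ A, 0 < A ∧ z = A ^ 2 :=
    ⟨Real.sqrt z, Real.sqrt_pos.2 hz, (Real.sq_sqrt hz.le).symm⟩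
  obtain ⟨w, hw⟩ : ∃ w, w = z / (z - x) := ⟨_, rfl⟩
  obtain ⟨m, hm⟩ : ∃ m, m = (z - y) / (z - x) := ⟨_, rfl⟩
  have hwpos : 0 < w := hw ▸ div_pos hz hzx
  have hm0 : 0 ≤ m := hm ▸ div_nonneg (by linarith) hzx.le
  have hmw : m ≤ w := by rw [hm, hw]; gcongr; linarith
  have hw1 : w ≤ 1 := by rw [hw, div_le_one hzx]; linarith
  have hx' : x = A ^ 2 / w * (w - 1) := by
    rw [← hAz, hw]; field_simp; ring
  have hy' : y = A ^ 2 / w * (w - m) := by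
    rw [← hAz, hw, hm]; field_simp; ring
  have hlam : lam = A ^ 2 / (2 * w) * (3 * w - m - 1) := by
    have : 2 * lam = 2 * (A ^ 2 / (2 * w) * (3 * w - m - 1)) := by
      rw [h1, hx', hy', hAz]; field_simp; ring
    linarith
  have hc : 4 * c ^ 2 = A ^ 6 / w ^ 2 * (1 - w) * (w - m) := by
    rw [h3, hx', hy', hAz]; field_simp; ring
  have he : 4 * e = -(A ^ 4 / w ^ 2 * ((w - 1) * (w - m) + w * (w - 1) + w * (w - m))) := by
    rw [h2, hx', hy', hAz]; field_simp
  obtain ⟨g, hsn, hg, hgsq, hrange⟩ := exists_deriv_jacobiSn hm0 (hmw.trans hw1)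
  -- The value sn² must take at x₀. If y = z, then u x₀ = z and m = 0, and the default 0/0 = 0 is
  -- harmless.
  set q := (z - u x₀) / (z - y) with hq
  have hzy : 0 ≤ z - y := by linarith
  have hq0 : 0 ≤ q := div_nonneg (by linarith) hzy
  have hq1 : q ≤ 1 := div_le_one_of_le₀ (by linarith) hzy
  have hmq : m * q = (z - u x₀) / (z - x) := by
    rcases hzy.eq_or_lt with h | h
    · have : z - u x₀ = 0 := by linarith
      rw [hm, ← h, this]; simp
    · rw [hm, hq]; field_simp
  -- Strict because u x₀ > 0 ≥ x; this keeps the value in reach when m = 1.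
  have hmq1 : m * q < 1 := by
    rw [hmq, div_lt_one hzx]; linarith
  -- V is a nonpositive multiple of sn · g, and g ≥ 0 at the chosen point, so sn gets the sign
  -- opposite to v x₀.
  obtain ⟨r, hr, hrs⟩ : ∃ r : ℝ, r ^ 2 = q ∧ r * v x₀ ≤ 0 := by
    rcases le_total 0 (v x₀) with h | h
    · refine ⟨-Real.sqrt q, by rw [neg_sq, Real.sq_sqrt hq0], ?_⟩
      nlinarith [Real.sqrt_nonneg q, mul_nonneg (Real.sqrt_nonneg q) h]
    · exact ⟨Real.sqrt q, Real.sq_sqrt hq0, mul_nonpos_of_nonneg_of_nonpos (Real.sqrt_nonneg q) h⟩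
  obtain ⟨t, ht, hgt⟩ := hrange r (hr ▸ hq1) (hr ▸ hmq1)
  refine ⟨m, w, A, t - A / (2 * Real.sqrt w) * x₀, ⟨hm0, hmw, hw1, hwpos, hA⟩, ?_, hlam, hc⟩
  obtain ⟨V, hVdef, hV⟩ := curvatureProfile_equation (A := A) hwpos hsn hg hgsq
    (t - A / (2 * Real.sqrt w) * x₀)
  have hU0 : u x₀ = curvatureProfile m w A (t - A / (2 * Real.sqrt w) * x₀) x₀ := by
    rw [curvatureProfile, add_sub_cancel, ht, hr, div_mul_eq_mul_div, hmq, ← hAz, hw]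
    field_simp
    ring
  have hVv : v x₀ = V x₀ := by
    have hsqeq : v x₀ ^ 2 = V x₀ ^ 2 := by
      rw [(hV x₀).2.2, hsq x₀ hx₀, ← hU0, ← hlam, ← he, ← hc]
    have hsign : 0 ≤ v x₀ * V x₀ := by
      rw [hVdef, add_sub_cancel, ht]
      have hk : 0 ≤ A ^ 2 * (m / w) * (A / Real.sqrt w) := by positivity
      refine (mul_nonneg hk (mul_nonneg (neg_nonneg.2 hrs) hgt)).trans_eq ?_
      ring
    rcases sq_eq_sq_iff_eq_or_eq_neg.1 hsqeq with h | h
    · exact h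
    · rw [h] at hsign
      have : V x₀ = 0 := mul_self_eq_zero.1 (le_antisymm (by linarith) (mul_self_nonneg _))
      rw [h, this, neg_zero]
  refine eqOn_of_quadratic_second_order hu hv (fun s _ => (hV s).1.hasDerivWithinAt) (fun s _ => ?_)
    hx₀ hU0 hVv
  refine (hV s).2.1.hasDerivWithinAt.congr_deriv ?_
  rw [← he, ← hlam]
  ring

end CurvatureProfile

end Elastica

/-! ### Existence and uniqueness of the quadruple. -/

theorem theorem2p8 (lam L : ℝ) (γ : ℝ → EuclideanSpace ℝ (Fin 3))
    (hγ : Elastica.IsElastica lam 0 L γ)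
    (harc : Elastica.IsArclength 0 L γ)
    (hseg : ¬ Elastica.IsStraightSegment 0 L γ) :
    ∃! p : ℝ × ℝ × ℝ × ℝ, match p with
      | (m, w, A, c) =>
        (0 ≤ m ∧ m ≤ w ∧ w ≤ 1 ∧ 0 < w ∧ 0 < A) ∧
        (∃ s₀ : ℝ, ∀ s ∈ Set.Icc 0 L,
          ‖Elastica.curvature 0 L γ s‖ ^ 2 =
            A ^ 2 * (1 - m / w *
              Elastica.jacobiSn (A / (2 * Real.sqrt w) * s + s₀) m ^ 2)) ∧
        (∀ s ∈ Set.Icc 0 L, Elastica.detFrame 0 L γ s = c) ∧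
        lam = A ^ 2 / (2 * w) * (3 * w - m - 1) ∧
        4 * c ^ 2 = A ^ 6 / w ^ 2 * (1 - w) * (w - m) := by
  have hL := hγ.smooth.lt
  have h0 : (0 : ℝ) ∈ Set.Icc 0 L := Set.left_mem_Icc.2 hL.le
  obtain ⟨x₀, hx₀, hpos⟩ := Elastica.exists_curvature_pos hγ.smooth harc hseg
  obtain ⟨e, v, huv⟩ := Elastica.exists_curvature_equation hγ harc
  -- At x₀ the curve's cubic and the profile's take the same value v(x₀)² and differ only in the
  -- linear term; u(x₀) > 0 can be cancelled.
  have hparam : ∀ m w A c : ℝ, (0 ≤ m ∧ m ≤ w ∧ w ≤ 1 ∧ 0 < w ∧ 0 < A) →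
      (∃ s₀ : ℝ, ∀ s ∈ Set.Icc 0 L, ‖Elastica.curvature 0 L γ s‖ ^ 2 =
        Elastica.curvatureProfile m w A s₀ s) →
      c = Elastica.detFrame 0 L γ 0 →
      lam = A ^ 2 / (2 * w) * (3 * w - m - 1) →
      4 * c ^ 2 = A ^ 6 / w ^ 2 * (1 - w) * (w - m) →
      A ^ 4 / w ^ 2 * ((w - 1) * (w - m) + w * (w - 1) + w * (w - m)) = -(4 * e) := by
    rintro m w A c ⟨hm, hmw, hw1, hw, hA⟩ ⟨s₀, hs₀⟩ hc hlam hc2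
    obtain ⟨g, hsn, hg, hgsq, -⟩ := Elastica.exists_deriv_jacobiSn hm (hmw.trans hw1)
    obtain ⟨V, -, hV⟩ := Elastica.curvatureProfile_equation (A := A) hw hsn hg hgsq s₀
    have hvV : v x₀ = V x₀ := (uniqueDiffOn_Icc hL x₀ hx₀).eq_deriv _ (huv x₀ hx₀).1
      ((hV x₀).1.hasDerivWithinAt.congr hs₀ (hs₀ x₀ hx₀))
    have h1 := (huv x₀ hx₀).2.2
    have h2 := (hV x₀).2.2
    rw [← hvV, ← hs₀ x₀ hx₀, ← hlam, ← hc2, hc] at h2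
    have h3 : (A ^ 4 / w ^ 2 * ((w - 1) * (w - m) + w * (w - 1) + w * (w - m)) + 4 * e) *
        ‖Elastica.curvature 0 L γ x₀‖ ^ 2 = 0 := by
      linear_combination h2 - h1
    rcases mul_eq_zero.1 h3 with h | h
    · linarith
    · exact absurd h hpos.ne'
  obtain ⟨m, w, A, s₀, hr, hprof, hlam, hc⟩ := Elastica.exists_curvatureProfile
    (fun x hx => (huv x hx).1) (fun x hx => (huv x hx).2.1) (fun x hx => (huv x hx).2.2) hx₀ hpos
  refine ⟨(m, w, A, Elastica.detFrame 0 L γ 0),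
    ⟨hr, ⟨s₀, hprof⟩, Elastica.detFrame_eq hγ harc, hlam, hc⟩, ?_⟩
  rintro ⟨m', w', A', c'⟩ ⟨hr', hprof', hdet', hlam', hc'⟩
  have hcc : c' = Elastica.detFrame 0 L γ 0 := (hdet' 0 h0).symm
  have he' := hparam m' w' A' c' hr' hprof' hcc hlam' hc'
  have he := hparam m w A _ hr ⟨s₀, hprof⟩ rfl hlam hc
  obtain ⟨hm, hmw, hw1, hw, hA⟩ := hr
  obtain ⟨hm', hmw', hw1', hw', hA'⟩ := hr'
  subst hcc
  obtain ⟨rfl, rfl, rfl⟩ := Elastica.eq_params_of_eq_roots hw' hA' hmw' hm' hw1' hw hA hmw hm hw1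
    (hlam'.symm.trans hlam) (he'.trans he.symm) (hc'.symm.trans hc)
  rfl
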